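/- Let $n,m\ge 1$ and let $P(\lambda)=P_m\lambda^m+\cdots+P_1\lambda+P_0$ be an $n\times n$ matrix polynomial with $P_0,\dots,P_m\in\mathbb{C}^{n\times n}$ and $\det P_m\neq 0$; its eigenvalues are the $\lambda\in\mathbb{C}$ with $\det P(\lambda)=0$. Let $w_0,\dots,w_m$ be real weights with $w_0>0$ and $w_j\ge 0$ for $j=1,\dots,m$. For $\varepsilon>0$ let the weighted $\varepsilon$-pseudospectrum of $P$ be $$\Lambda_\varepsilon(P)=\Bigl\{\mu\in\mathbb{C}:\ \det\Bigl(\sum_{j=0}^m (P_j+\Delta_j)\mu^j\Bigr)=0\ \text{ for some } \Delta_0,\dots,\Delta_m\in\mathbb{C}^{n\times n}\text{ with } \|\Delta_j\|\le\varepsilon w_j,\ j=0,\dots,m\Bigr\},$$ where $\|\cdot\|$ is the spectral norm (the matrix norm subordinate to the Euclidean vector norm). If $P$ has exactly $k$ distinct eigenvalues (not necessarily simple), then for every $\varepsilon>0$ the set $\Lambda_\varepsilon(P)$ has at most $k$ connected components. ($\Lambda_\varepsilon(P)$ is not assumed to be bounded.) -/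

import Mathlib

/-- An `n × n` complex matrix polynomial
`P(z) = P_m z ^ m + ⋯ + P_1 z + P_0`, given by its coefficients `P j = P_j`, `0 ≤ j ≤ m`. -/
abbrev MatrixPolynomial (n m : ℕ) : Type :=
  Fin (m + 1) → Matrix (Fin n) (Fin n) ℂ

namespace MatrixPolynomial

/-- The value `P(z)`, an `n × n` complex matrix. -/
def eval {n m : ℕ} (P : MatrixPolynomial n m) (z : ℂ) : Matrix (Fin n) (Fin n) ℂ :=
  ∑ j : Fin (m + 1), z ^ (j : ℕ) • P j

/-- The leading coefficient `P_m`. -/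
def leadingCoeff {n m : ℕ} (P : MatrixPolynomial n m) : Matrix (Fin n) (Fin n) ℂ :=
  P (Fin.last m)

/-- The set of eigenvalues of `P`. -/
def eigenvalues {n m : ℕ} (P : MatrixPolynomial n m) : Set ℂ :=
  {z : ℂ | (P.eval z).det = 0}

section

open scoped Matrix.Norms.L2Operator

/-- The admissible perturbations `Q` of `P`: the coefficientwise differences `Δ_j = Q_j - P_j`
satisfy `‖Δ_j‖ ≤ ε w_j` for all `0 ≤ j ≤ m`, in the spectral norm (the operator norm subordinate
to the Euclidean vector norm). -/
def admissible {n m : ℕ} (P : MatrixPolynomial n m) (w : Fin (m + 1) → ℝ) (ε : ℝ) :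
    Set (MatrixPolynomial n m) :=
  {Q | ∀ j : Fin (m + 1), ‖Q j - P j‖ ≤ ε * w j}

end

/-- The `ε`-pseudospectrum of `P` with respect to the weights `w`: all eigenvalues of all
admissible perturbations of `P`. -/
def pseudospectrum {n m : ℕ} (P : MatrixPolynomial n m) (w : Fin (m + 1) → ℝ) (ε : ℝ) : Set ℂ :=
  {z : ℂ | ∃ Q ∈ P.admissible w ε, (Q.eval z).det = 0}

end MatrixPolynomial

/-! ### Superlevel sets of functions with a maximum principle on the sphere -/

section

open Filter Topology Set

/-! Let `F z = ‖P(z)⁻¹‖ * ∑ j, w j * |z| ^ j`. Since the distance from an invertible `A` to the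
singular matrices is `1 / ‖A⁻¹‖`, the pseudospectrum consists of the eigenvalues and the points
where `F ≥ 1/ε` (`pseudospectrum_eq`). It suffices that every component of this set contains an
eigenvalue (`exists_mem_connectedComponentIn`).

Off the eigenvalues `F` obeys a strong maximum principle: at each point it is touched from below by
the norm of a holomorphic matrix function. It tends to infinity at the eigenvalues. As `det P_m ≠
0`, the substitution `z ↦ z⁻¹` turns `F` into the same kind of function for the reversed polynomial,
regular at `0`; so the principle also holds at infinity, and unbounded components need no separate
theory.

On a component without a pole, `F` would have an interior maximum and be locally constant there.
That makes a set free of poles clopen in the plane, hence the whole plane, although poles exist. -/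

theorem Complex.isPreconnected_setOf_lt_norm {R : ℝ} (hR : 0 < R) :
    IsPreconnected {z : ℂ | R < ‖z‖} := by
  -- The exterior of a disc is the image of a half-plane under `exp`.
  have h : {z : ℂ | R < ‖z‖} = Complex.exp '' {z : ℂ | Real.log R < z.re} := by
    ext z
    constructor
    · intro hz
      have hz' : R < ‖z‖ := hz
      have h0 : z ≠ 0 := norm_pos_iff.mp (hR.trans hz')
      exact ⟨Complex.log z, by simpa [Complex.log_re] using Real.log_lt_log hR hz',
        Complex.exp_log h0⟩
    · rintro ⟨y, hy, rfl⟩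
      simpa [Complex.norm_exp] using (Real.log_lt_iff_lt_exp hR).mp hy
  rw [h]
  exact (convex_halfSpace_re_gt _).isPreconnected.image _ Complex.continuous_exp.continuousOn

/-- A real function on the plane which is continuous and satisfies the strong maximum principle
off a finite set `E` of poles, and also at infinity, where it takes the value `L`. -/
structure HasMaximumPrincipleOffPoles (F : ℂ → ℝ) (E : Set ℂ) (L : ℝ) : Prop where
  finite : E.Finite
  -- Rules out constant `F` without poles, where a superlevel set can be the whole plane.
  nonempty : E.Nonempty
  continuousAt : ∀ z ∉ E, ContinuousAt F z
  tendsto_atTop : ∀ z ∈ E, Tendsto F (𝓝[≠] z) atTop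
  eventually_eq_of_isLocalMax : ∀ z ∉ E, IsLocalMax F z → ∀ᶠ y in 𝓝 z, F y = F z
  tendsto_cocompact : Tendsto F (cocompact ℂ) (𝓝 L)
  eventually_eq_of_eventually_le :
    (∀ᶠ z in cocompact ℂ, F z ≤ L) → ∀ᶠ z in cocompact ℂ, F z = L

namespace HasMaximumPrincipleOffPoles

variable {F : ℂ → ℝ} {E : Set ℂ} {L : ℝ}

theorem isOpen_union (h : HasMaximumPrincipleOffPoles F E L) (c : ℝ) :
    IsOpen (E ∪ {z | c < F z}) := by
  rw [isOpen_iff_mem_nhds]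
  intro z hz
  by_cases hE : z ∈ E
  · have := (h.tendsto_atTop z hE).eventually_gt_atTop c
    rw [eventually_nhdsWithin_iff] at this
    filter_upwards [this] with y hy
    by_cases hyz : y = z
    · exact Or.inl (hyz ▸ hE)
    · exact Or.inr (hy hyz)
  · have hz' : c < F z := hz.resolve_left hE
    filter_upwards [(h.continuousAt z hE).eventually_const_lt hz'] with y hy
    exact Or.inr hy

theorem isClosed_union (h : HasMaximumPrincipleOffPoles F E L) (c : ℝ) :
    IsClosed (E ∪ {z | c ≤ F z}) := by
  rw [← isOpen_compl_iff, isOpen_iff_mem_nhds]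
  intro z hz
  simp only [mem_compl_iff, mem_union, not_or, mem_ofPred_eq, not_le] at hz
  filter_upwards [(h.continuousAt z hz.1).eventually_lt_const hz.2,
    h.finite.isClosed.isOpen_compl.mem_nhds hz.1] with y hy hyE
  simp only [mem_compl_iff, mem_union, not_or, mem_ofPred_eq, not_le]
  exact ⟨hyE, hy⟩

/-- A component of the strict superlevel set on which `F` is dominated near infinity by one of its
values contains a pole. -/
theorem exists_mem_connectedComponentIn_of_eventually_le (h : HasMaximumPrincipleOffPoles F E L)
    {c : ℝ} {z x : ℂ} (hx : x ∈ connectedComponentIn (E ∪ {z | c < F z}) z)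
    (hle : ∀ᶠ y in cocompact ℂ,
      y ∈ closure (connectedComponentIn (E ∪ {z | c < F z}) z) → F y ≤ F x) :
    ∃ e ∈ E, e ∈ connectedComponentIn (E ∪ {z | c < F z}) z := by
  by_contra! hE
  set O := E ∪ {z | c < F z} with hO
  set V := connectedComponentIn O z with hV
  have hVO : V ⊆ O := connectedComponentIn_subset _ _
  have hVopen : IsOpen V := (h.isOpen_union c).connectedComponentIn
  have hVconn : IsPreconnected V := isPreconnected_connectedComponentIn
  have hVlt : ∀ y ∈ V, c < F y := fun y hy =>
    (hVO hy).resolve_left fun hyE => hE y hyE hy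
  -- A component of the open set `O` is relatively closed in `O`, so boundary points of `V` lie
  -- outside `O`; in particular they are not poles.
  have hclO : ∀ y ∈ closure V, y ∈ O → y ∈ V := by
    intro y hy hyO
    obtain ⟨t, ht, htV⟩ := mem_closure_iff_nhds.mp hy _
      ((h.isOpen_union c).connectedComponentIn.mem_nhds (mem_connectedComponentIn hyO))
    have h1 := connectedComponentIn_eq ht
    have h2 := connectedComponentIn_eq htV
    rw [hV, h2, ← h1]
    exact mem_connectedComponentIn hyO
  have hclE : ∀ y ∈ closure V, y ∉ E := fun y hy hyE =>
    hE y hyE (hclO y hy (Or.inl hyE))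
  have hcont : ContinuousOn F (closure V) := fun y hy =>
    (h.continuousAt y (hclE y hy)).continuousWithinAt
  obtain ⟨b, hb, hmax⟩ := hcont.exists_isMaxOn' isClosed_closure (subset_closure hx)
    (eventually_inf_principal.mpr hle)
  have hbc : c < F b := (hVlt x hx).trans_le (hmax (subset_closure hx))
  -- The set where the maximum is attained is open by the maximum principle, and closed because its
  -- limit points still have value `F b > c` and so stay in `V`.
  have hM : IsOpen {y | y ∈ V ∧ F y = F b} := by
    rw [isOpen_iff_mem_nhds]
    rintro y ⟨hyV, hy⟩
    have hloc : IsLocalMax F y := by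
      filter_upwards [hVopen.mem_nhds hyV] with t ht
      rw [hy]
      exact hmax (subset_closure ht)
    filter_upwards [h.eventually_eq_of_isLocalMax y (fun hyE => hE y hyE hyV) hloc,
      hVopen.mem_nhds hyV] with t ht htV
    exact ⟨htV, ht.trans hy⟩
  have hMcl : closure {y | y ∈ V ∧ F y = F b} ⊆ {y | y ∈ V ∧ F y = F b} := by
    intro y hy
    have hycl : y ∈ closure V := closure_mono (fun t ht => ht.1) hy
    have hyb : F y = F b := by
      have hca := h.continuousAt y (hclE y hycl)
      have : ∃ᶠ t in 𝓝 y, F t = F b :=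
        (mem_closure_iff_frequently.mp hy).mono fun t ht => ht.2
      by_contra hne
      exact this (hca.eventually_ne hne)
    exact ⟨hclO y hycl (Or.inr (by rw [mem_ofPred_eq, hyb]; exact hbc)), hyb⟩
  have hclopen : IsClopen {y | y ∈ V ∧ F y = F b} :=
    ⟨isClosed_of_closure_subset hMcl, hM⟩
  have huniv := hclopen.eq_univ ⟨b, hclO b hb (Or.inr hbc), rfl⟩
  obtain ⟨e, he⟩ := h.nonempty
  have : e ∈ {y | y ∈ V ∧ F y = F b} := huniv ▸ mem_univ e
  exact hE e he this.1

/-- Every component of a strict superlevel set contains a pole. -/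
theorem exists_mem_connectedComponentIn_of_lt (h : HasMaximumPrincipleOffPoles F E L)
    {c : ℝ} {z : ℂ} (hz : z ∈ E ∪ {z | c < F z}) :
    ∃ e ∈ E, e ∈ connectedComponentIn (E ∪ {z | c < F z}) z := by
  set O := E ∪ {z | c < F z} with hO
  set V := connectedComponentIn O z with hV
  have hzV : z ∈ V := mem_connectedComponentIn hz
  by_cases hzE : z ∈ E
  · exact ⟨z, hzE, hzV⟩
  have hcz : c < F z := hz.resolve_left hzE
  -- If `F` exceeds `L` somewhere on `V`, that value dominates near infinity. Otherwise `c < L`, so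
  -- the exterior of a large disc lies in `O`; being connected, it is contained in `V` or disjoint
  -- from it.
  by_cases hL : ∃ x ∈ V, L < F x
  · obtain ⟨x, hxV, hx⟩ := hL
    exact h.exists_mem_connectedComponentIn_of_eventually_le hxV <|
      (h.tendsto_cocompact.eventually_lt_const hx).mono fun y hy _ => hy.le
  push Not at hL
  have hcL : c < L := hcz.trans_le (hL z hzV)
  obtain ⟨R, hR0, hR⟩ : ∃ R : ℝ, 0 < R ∧ ∀ y : ℂ, R < ‖y‖ → c < F y := by
    have := h.tendsto_cocompact.eventually_const_lt hcL
    rw [← Metric.cobounded_eq_cocompact, ← comap_norm_atTop] at this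
    obtain ⟨r, hr⟩ := eventually_atTop.mp (eventually_comap.mp this)
    exact ⟨max r 1, by positivity, fun y hy => hr _ ((le_max_left r 1).trans hy.le) y rfl⟩
  have hfar : ∀ᶠ y : ℂ in cocompact ℂ, R < ‖y‖ := by
    rw [← Metric.cobounded_eq_cocompact]
    exact tendsto_norm_cobounded_atTop.eventually_gt_atTop R
  by_cases hmeet : ∃ y ∈ V, R < ‖y‖
  · obtain ⟨y, hyV, hy⟩ := hmeet
    have hsub : {t : ℂ | R < ‖t‖} ⊆ V := by
      rw [hV, connectedComponentIn_eq hyV]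
      exact (Complex.isPreconnected_setOf_lt_norm hR0).subset_connectedComponentIn hy
        fun t ht => Or.inr (hR t ht)
    have hle : ∀ᶠ t in cocompact ℂ, F t ≤ L := hfar.mono fun t ht => hL t (hsub ht)
    -- Here infinity is a local maximum, so the value `L` is attained at a finite point of `V`.
    obtain ⟨x, hx, hxL⟩ := (hfar.and (h.eventually_eq_of_eventually_le hle)).exists
    exact h.exists_mem_connectedComponentIn_of_eventually_le (hsub hx)
      (hle.mono fun t ht _ => hxL ▸ ht)
  · push Not at hmeet
    refine h.exists_mem_connectedComponentIn_of_eventually_le hzV (hfar.mono fun t ht hcl => ?_)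
    have : closure V ⊆ {t | ‖t‖ ≤ R} :=
      closure_minimal hmeet (isClosed_le continuous_norm continuous_const)
    exact absurd (this hcl) (not_le.mpr ht)

/-- Every component of a superlevel set contains a pole. -/
theorem exists_mem_connectedComponentIn (h : HasMaximumPrincipleOffPoles F E L)
    {c : ℝ} {z : ℂ} (hz : z ∈ E ∪ {z | c ≤ F z}) :
    ∃ e ∈ E, e ∈ connectedComponentIn (E ∪ {z | c ≤ F z}) z := by
  by_contra! hE
  set O := E ∪ {z | c < F z} with hO
  set S := E ∪ {z | c ≤ F z} with hS
  set K := connectedComponentIn S z with hK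
  have hOS : O ⊆ S := union_subset_union_right _ fun y (hy : c < F y) => hy.le
  have hSclosed : IsClosed S := h.isClosed_union c
  -- `O` is a finite union of components through poles, so its closure is the union of their
  -- closures, each lying in the component of `S` of a pole.
  have hdisj : ∀ y ∈ K, y ∉ closure O := by
    intro y hyK hy
    have hcover : O ⊆ ⋃ e ∈ E, connectedComponentIn O e := by
      intro t ht
      obtain ⟨e, he, het⟩ := h.exists_mem_connectedComponentIn_of_lt ht
      refine mem_iUnion₂.mpr ⟨e, he, ?_⟩
      rw [← connectedComponentIn_eq het]
      exact mem_connectedComponentIn ht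
    have hy' := closure_mono hcover hy
    rw [h.finite.closure_biUnion] at hy'
    obtain ⟨e, he, hye⟩ := mem_iUnion₂.mp hy'
    have hsub : closure (connectedComponentIn O e) ⊆ connectedComponentIn S y :=
      (isPreconnected_connectedComponentIn.closure).subset_connectedComponentIn hye
        (closure_minimal ((connectedComponentIn_subset _ _).trans hOS) hSclosed)
    refine hE e he ?_
    rw [hK, connectedComponentIn_eq hyK]
    exact hsub (subset_closure (mem_connectedComponentIn (Or.inl he)))
  have hKopen : IsOpen K := by
    rw [isOpen_iff_mem_nhds]
    intro y hyK
    have hyE : y ∉ E := fun hyE => hE y hyE hyK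
    have hcy : c ≤ F y := (connectedComponentIn_subset _ _ hyK : y ∈ S).resolve_left hyE
    have hyO := hdisj y hyK
    -- Away from `closure O` the level `c` is not exceeded, so each point of `K` is a local maximum
    -- and `F` is constant around it; thus `K` is open.
    have hnear : ∀ᶠ t in 𝓝 y, F t ≤ c := by
      filter_upwards [isClosed_closure.isOpen_compl.mem_nhds hyO] with t ht
      by_contra! hlt
      exact ht (subset_closure (Or.inr hlt))
    have hloc : IsLocalMax F y := hnear.mono fun t ht => ht.trans hcy
    have hSnhds : S ∈ 𝓝 y := by
      filter_upwards [h.eventually_eq_of_isLocalMax y hyE hloc] with t ht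
      exact Or.inr (by rw [mem_ofPred_eq, ht]; exact hcy)
    rw [hK, connectedComponentIn_eq hyK]
    exact connectedComponentIn_mem_nhds hSnhds
  have hKclosed : IsClosed K := isClosed_of_closure_subset <|
    isPreconnected_connectedComponentIn.closure.subset_connectedComponentIn
      (subset_closure (mem_connectedComponentIn hz))
      (closure_minimal (connectedComponentIn_subset _ _) hSclosed)
  have huniv := IsClopen.eq_univ ⟨hKclosed, hKopen⟩ ⟨z, mem_connectedComponentIn hz⟩
  obtain ⟨e, he⟩ := h.nonempty
  exact hE e he (huniv ▸ mem_univ e)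

/-- A superlevel set has at most as many components as there are poles. -/
theorem card_connectedComponents_le (h : HasMaximumPrincipleOffPoles F E L) (c : ℝ) :
    ENat.card (ConnectedComponents ↥(E ∪ {z | c ≤ F z})) ≤ E.encard := by
  rw [← ENat.card_coe_set_eq]
  let f : E → ConnectedComponents ↥(E ∪ {z | c ≤ F z}) := fun e =>
    ConnectedComponents.mk ⟨e, Or.inl e.2⟩
  have hf : Function.Surjective f := by
    intro q
    obtain ⟨⟨z, hz⟩, rfl⟩ := ConnectedComponents.surjective_coe q
    obtain ⟨e, he, hez⟩ := h.exists_mem_connectedComponentIn hz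
    refine ⟨⟨e, he⟩, ?_⟩
    rw [ConnectedComponents.coe_eq_coe']
    rw [connectedComponentIn_eq_image hz] at hez
    obtain ⟨e', he', rfl⟩ := hez
    exact he'
  exact ENat.card_le_card_of_injective (Function.injective_surjInv hf)

end HasMaximumPrincipleOffPoles

end

/-! ### Distance of a matrix to the singular matrices -/

-- Otherwise `A⁻¹ * B = 1 - A⁻¹ * (A - B)` would be invertible by the Neumann series.
open scoped Matrix.Norms.L2Operator in
theorem Matrix.one_le_norm_inv_mul_norm_sub {n : ℕ} {A B : Matrix (Fin n) (Fin n) ℂ}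
    (hA : A.det ≠ 0) (hB : B.det = 0) : 1 ≤ ‖A⁻¹‖ * ‖A - B‖ := by
  by_contra! h
  have hu : IsUnit (1 - A⁻¹ * (A - B)) :=
    (Units.oneSub _ ((norm_mul_le _ _).trans_lt h)).isUnit
  have hAu : IsUnit A.det := hA.isUnit
  have hAB : 1 - A⁻¹ * (A - B) = A⁻¹ * B := by
    rw [mul_sub, Matrix.nonsing_inv_mul _ hAu, sub_sub_cancel]
  rw [hAB, Matrix.isUnit_iff_isUnit_det, Matrix.det_mul, hB, mul_zero] at hu
  exact not_isUnit_zero hu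

theorem ContinuousLinearMap.exists_norm_apply_eq {E F : Type*} [NormedAddCommGroup E]
    [NormedSpace ℂ E] [FiniteDimensional ℂ E] [Nontrivial E] [NormedAddCommGroup F]
    [NormedSpace ℂ F] (T : E →L[ℂ] F) : ∃ v, ‖v‖ = 1 ∧ ‖T v‖ = ‖T‖ := by
  have : ProperSpace E := FiniteDimensional.proper ℂ E
  have : NormedSpace ℝ E := NormedSpace.restrictScalars ℝ ℂ E
  obtain ⟨v, hv, hmax⟩ := (isCompact_sphere (0 : E) 1).exists_isMaxOn
    (NormedSpace.sphere_nonempty.mpr zero_le_one) (T.continuous.norm.continuousOn)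
  have hv1 : ‖v‖ = 1 := by simpa using hv
  refine ⟨v, hv1, le_antisymm (T.unit_le_opNorm v hv1.le) ?_⟩
  refine T.opNorm_le_of_unit_norm (norm_nonneg _) fun x hx => hmax ?_
  simpa using hx

-- For a unit vector `v` at which `A⁻¹` attains its norm and `u = A⁻¹ v`, the rank-one matrix `D =
-- -‖u‖⁻² v u*` satisfies `(A + D) u = 0` and `‖D‖ = 1 / ‖u‖`.
open scoped Matrix.Norms.L2Operator in
theorem Matrix.exists_norm_le_det_add_eq_zero {n : ℕ} [NeZero n] {A : Matrix (Fin n) (Fin n) ℂ}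
    (hA : A.det ≠ 0) : ∃ D : Matrix (Fin n) (Fin n) ℂ, ‖D‖ ≤ ‖A⁻¹‖⁻¹ ∧ (A + D).det = 0 := by
  obtain ⟨v, hv, hTv⟩ := (Matrix.toEuclideanCLM (n := Fin n) (𝕜 := ℂ) A⁻¹).exists_norm_apply_eq
  set u := Matrix.toEuclideanCLM (n := Fin n) (𝕜 := ℂ) A⁻¹ v with hu
  have hAu : Matrix.toEuclideanCLM (n := Fin n) (𝕜 := ℂ) A u = v := by
    rw [hu, ← mul_apply_eq_comp, ← map_mul, Matrix.mul_nonsing_inv _ hA.isUnit,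
      map_one, one_apply_eq_self]
  have hu0 : u ≠ 0 := by
    rintro h
    rw [h, map_zero] at hAu
    simp [← hAu] at hv
  have hun : ‖u‖ ≠ 0 := norm_ne_zero_iff.mpr hu0
  rw [Matrix.l2_opNorm_toEuclideanCLM] at hTv
  refine ⟨(Matrix.toEuclideanCLM (n := Fin n) (𝕜 := ℂ)).symm
    (-((‖u‖ : ℂ) ^ 2)⁻¹ • InnerProductSpace.rankOne ℂ v u), ?_, ?_⟩
  · rw [Matrix.cstar_norm_def, StarAlgEquiv.apply_symm_apply, norm_smul,
      InnerProductSpace.norm_rankOne, hv, ← hTv]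
    simp only [norm_neg, norm_inv, norm_pow, Complex.norm_real, norm_norm]
    apply le_of_eq
    field_simp
  · refine Matrix.exists_mulVec_eq_zero_iff.mp ⟨u.ofLp, fun h => hu0 ?_, ?_⟩
    · exact WithLp.ofLp_injective 2 h
    · rw [← Matrix.ofLp_toEuclideanCLM, map_add, StarAlgEquiv.apply_symm_apply]
      have : (‖u‖ : ℂ) ≠ 0 := by exact_mod_cast hun
      simp [hAu, InnerProductSpace.rankOne_apply, inner_self_eq_norm_sq_to_K, smul_smul, this]

/-! ### The scaled resolvent norm and its behaviour at poles and at infinity -/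

namespace MatrixPolynomial

open Filter Topology
open scoped Matrix.Norms.L2Operator

variable {n m : ℕ}

/-- The scaled resolvent norm `‖P(z)⁻¹‖ * ∑ j, w j * |z| ^ j`. -/
noncomputable def weightedResolventNorm (P : MatrixPolynomial n m) (w : Fin (m + 1) → ℝ) (z : ℂ) :
    ℝ :=
  ‖(P.eval z)⁻¹‖ * ∑ j : Fin (m + 1), w j * ‖z‖ ^ (j : ℕ)

/-- The reversed polynomial `z ^ m * P(z⁻¹)`. -/
def reverse (P : MatrixPolynomial n m) : MatrixPolynomial n m := fun j => P j.rev

theorem differentiable_eval (P : MatrixPolynomial n m) : Differentiable ℂ P.eval := by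
  unfold eval
  fun_prop

theorem differentiableAt_inv_eval (P : MatrixPolynomial n m) {z : ℂ} (hz : z ∉ P.eigenvalues) :
    DifferentiableAt ℂ (fun y => (P.eval y)⁻¹) z := by
  have hu : IsUnit (P.eval z) :=
    (Matrix.isUnit_iff_isUnit_det _).mpr (Ne.isUnit hz)
  simp only [Matrix.nonsing_inv_eq_ringInverse]
  exact (differentiableAt_inverse (𝕜 := ℂ) hu).comp z (P.differentiable_eval z)

theorem isOpen_compl_eigenvalues (P : MatrixPolynomial n m) : IsOpen P.eigenvaluesᶜ := by
  have : Continuous fun z => (P.eval z).det := P.differentiable_eval.continuous.matrix_det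
  exact (isClosed_singleton.preimage this).isOpen_compl

theorem continuousAt_weightedResolventNorm (P : MatrixPolynomial n m) (w : Fin (m + 1) → ℝ) {z : ℂ}
    (hz : z ∉ P.eigenvalues) : ContinuousAt (P.weightedResolventNorm w) z :=
  (P.differentiableAt_inv_eval hz).continuousAt.norm.mul (by fun_prop)

theorem exists_norm_eq_one_mul_pow (z : ℂ) (j : ℕ) :
    ∃ a : ℂ, ‖a‖ = 1 ∧ a * z ^ j = (‖z‖ : ℂ) ^ j := by
  obtain ⟨c, hc, h⟩ := Complex.exists_norm_eq_mul_self z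
  exact ⟨c ^ j, by simp [hc], by rw [← mul_pow, ← h]⟩

/-- The weight sum is not the modulus of a holomorphic function, but rotating its terms by phases `a
j` chosen at `z` gives a polynomial `q` with `|q y| ≤ ∑ j, w j * |y| ^ j` and equality at `y = z`.
The maximum modulus principle for `q • P⁻¹` then squeezes `F` between two equal values. -/
theorem weightedResolventNorm_eventually_eq_of_isLocalMax (P : MatrixPolynomial n m)
    {w : Fin (m + 1) → ℝ} (hw : ∀ j, 0 ≤ w j) {z : ℂ} (hz : z ∉ P.eigenvalues)
    (hmax : IsLocalMax (P.weightedResolventNorm w) z) :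
    ∀ᶠ y in 𝓝 z, P.weightedResolventNorm w y = P.weightedResolventNorm w z := by
  choose a ha haz using fun j : Fin (m + 1) => exists_norm_eq_one_mul_pow z j
  set q : ℂ → ℂ := fun y => ∑ j : Fin (m + 1), w j * (a j * y ^ (j : ℕ)) with hq
  set g : ℂ → Matrix (Fin n) (Fin n) ℂ := fun y => q y • (P.eval y)⁻¹ with hg
  have hgle : ∀ y, ‖g y‖ ≤ P.weightedResolventNorm w y := by
    intro y
    rw [hg, norm_smul, mul_comm, weightedResolventNorm]
    gcongr
    refine (norm_sum_le _ _).trans (le_of_eq (Finset.sum_congr rfl fun j _ => ?_))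
    simp [ha, abs_of_nonneg (hw j)]
  have hgz : ‖g z‖ = P.weightedResolventNorm w z := by
    have hqz : q z = ((∑ j : Fin (m + 1), w j * ‖z‖ ^ (j : ℕ) : ℝ) : ℂ) := by
      simp only [hq, haz]
      push_cast
      rfl
    have h0 : 0 ≤ ∑ j : Fin (m + 1), w j * ‖z‖ ^ (j : ℕ) :=
      Finset.sum_nonneg fun j _ => mul_nonneg (hw j) (by positivity)
    rw [hg, norm_smul, mul_comm, weightedResolventNorm, hqz, Complex.norm_real,
      Real.norm_of_nonneg h0]
  have hgd : ∀ᶠ y in 𝓝 z, DifferentiableAt ℂ g y := by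
    filter_upwards [P.isOpen_compl_eigenvalues.mem_nhds hz] with y hy
    have hqd : DifferentiableAt ℂ q y := by fun_prop
    exact hqd.smul (P.differentiableAt_inv_eval hy)
  have hgmax : IsLocalMax (norm ∘ g) z := by
    filter_upwards [hmax] with y hy
    exact ((hgle y).trans hy).trans hgz.ge
  filter_upwards [Complex.norm_eventually_eq_of_isLocalMax hgd hgmax, hmax] with y hy hy'
  exact le_antisymm hy' (by rw [← hgz, ← hy]; exact hgle y)

/-- As `P(z)` is singular, `‖P(y)⁻¹‖ ≥ 1 / ‖P(y) - P(z)‖`, while the weight sum stays at least `w 0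
> 0`. -/
theorem weightedResolventNorm_tendsto_atTop (P : MatrixPolynomial n m)
    {w : Fin (m + 1) → ℝ} (hw : ∀ j, 0 ≤ w j) (hw0 : 0 < w 0) (hfin : P.eigenvalues.Finite)
    {z : ℂ} (hz : z ∈ P.eigenvalues) :
    Tendsto (P.weightedResolventNorm w) (𝓝[≠] z) atTop := by
  have hisol : ∀ᶠ y in 𝓝[≠] z, y ∉ P.eigenvalues := by
    have hmem : (P.eigenvalues \ {z})ᶜ ∈ 𝓝 z :=
      (hfin.subset Set.sdiff_subset).isClosed.isOpen_compl.mem_nhds (by simp)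
    filter_upwards [self_mem_nhdsWithin, mem_nhdsWithin_of_mem_nhds hmem] with y hy hy' hyE
    exact hy' ⟨hyE, hy⟩
  have hlim : Tendsto (fun y => ‖P.eval y - P.eval z‖) (𝓝[≠] z) (𝓝[>] 0) := by
    refine tendsto_nhdsWithin_iff.mpr ⟨?_, ?_⟩
    · have hc : ContinuousAt (fun y => ‖P.eval y - P.eval z‖) z :=
        ((P.differentiable_eval.continuous.sub continuous_const).norm).continuousAt
      simpa [ContinuousAt] using hc.tendsto.mono_left nhdsWithin_le_nhds
    · filter_upwards [hisol] with y hy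
      refine norm_pos_iff.mpr (sub_ne_zero.mpr fun h => hy ?_)
      rw [eigenvalues, Set.mem_ofPred_eq, h]
      exact hz
  refine tendsto_atTop_mono' _ ?_ (hlim.inv_tendsto_nhdsGT_zero.atTop_mul_const hw0)
  filter_upwards [hisol, tendsto_nhdsWithin_iff.mp hlim |>.2] with y hy hpos
  have hpos' : 0 < ‖P.eval y - P.eval z‖ := hpos
  have h1 := Matrix.one_le_norm_inv_mul_norm_sub hy hz
  have h2 : w 0 ≤ ∑ j : Fin (m + 1), w j * ‖y‖ ^ (j : ℕ) := by
    have := Finset.single_le_sum (f := fun j : Fin (m + 1) => w j * ‖y‖ ^ (j : ℕ))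
      (fun j _ => mul_nonneg (hw j) (by positivity)) (Finset.mem_univ 0)
    simpa using this
  exact mul_le_mul ((inv_le_iff_one_le_mul₀ hpos').mpr h1) h2 hw0.le (norm_nonneg _)

theorem eval_zero (P : MatrixPolynomial n m) : P.eval 0 = P 0 := by
  rw [eval, Finset.sum_eq_single 0]
  · simp
  · intro j _ hj
    rw [zero_pow (Fin.val_ne_zero_iff.mpr hj), zero_smul]
  · simp

theorem eval_reverse_inv (P : MatrixPolynomial n m) {z : ℂ} (hz : z ≠ 0) :
    P.eval z = z ^ m • P.reverse.eval z⁻¹ := by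
  rw [eval, eval, Finset.smul_sum]
  refine Fintype.sum_equiv Fin.revPerm _ _ fun j => ?_
  have hj : (j : ℕ) ≤ m := Nat.lt_succ_iff.mp j.2
  simp only [Fin.revPerm_apply, reverse, Fin.rev_rev, smul_smul, Fin.val_rev]
  congr 1
  rw [inv_pow, ← div_eq_mul_inv, eq_div_iff (by positivity), ← pow_add]
  congr 1
  omega

/-- The resolvent contributes `|z| ^ (-m)` and the weight sum `|z| ^ m`, which cancel. This is what
makes infinity an ordinary point. -/
theorem weightedResolventNorm_eq_reverse (P : MatrixPolynomial n m) (w : Fin (m + 1) → ℝ) {z : ℂ}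
    (hz : z ≠ 0) : P.weightedResolventNorm w z =
      P.reverse.weightedResolventNorm (fun j => w j.rev) z⁻¹ := by
  have hsum : ∑ j : Fin (m + 1), w j * ‖z‖ ^ (j : ℕ) =
      ‖z‖ ^ m * ∑ j : Fin (m + 1), w j.rev * ‖z⁻¹‖ ^ (j : ℕ) := by
    rw [Finset.mul_sum]
    refine Fintype.sum_equiv Fin.revPerm _ _ fun j => ?_
    have hj : (j : ℕ) ≤ m := Nat.lt_succ_iff.mp j.2
    have hz' : ‖z‖ ≠ 0 := norm_ne_zero_iff.mpr hz
    simp only [Fin.revPerm_apply, Fin.rev_rev, Fin.val_rev, norm_inv, inv_pow]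
    rw [mul_left_comm, ← div_eq_mul_inv]
    congr 1
    rw [eq_div_iff (by positivity), ← pow_add]
    congr 1
    omega
  have hzm : z ^ m ≠ 0 := pow_ne_zero _ hz
  have hinv : (P.eval z)⁻¹ = (z ^ m)⁻¹ • (P.reverse.eval z⁻¹)⁻¹ := by
    rw [P.eval_reverse_inv hz]
    by_cases hdet : IsUnit (P.reverse.eval z⁻¹).det
    · refine Matrix.inv_eq_left_inv ?_
      rw [Matrix.smul_mul, Matrix.mul_smul, smul_smul, inv_mul_cancel₀ hzm, one_smul,
        Matrix.nonsing_inv_mul _ hdet]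
    -- At an eigenvalue both inverses take the default value `0`.
    · have h2 : ¬IsUnit (z ^ m • P.reverse.eval z⁻¹).det := by
        rw [Matrix.det_smul, IsUnit.mul_iff]
        exact fun h => hdet h.2
      rw [Matrix.nonsing_inv_apply_not_isUnit _ hdet, Matrix.nonsing_inv_apply_not_isUnit _ h2,
        smul_zero]
  rw [weightedResolventNorm, weightedResolventNorm, hinv, hsum, norm_smul, norm_inv, norm_pow]
  have hz' : ‖z‖ ≠ 0 := norm_ne_zero_iff.mpr hz
  field_simp

theorem zero_notMem_eigenvalues_reverse (P : MatrixPolynomial n m)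
    (hP : P.leadingCoeff.det ≠ 0) : (0 : ℂ) ∉ P.reverse.eigenvalues := by
  rw [eigenvalues, Set.mem_ofPred_eq, eval_zero, reverse, Fin.rev_zero]
  exact hP

theorem weightedResolventNorm_tendsto_cocompact (P : MatrixPolynomial n m)
    (hP : P.leadingCoeff.det ≠ 0) (w : Fin (m + 1) → ℝ) :
    Tendsto (P.weightedResolventNorm w) (cocompact ℂ)
      (𝓝 (P.reverse.weightedResolventNorm (fun j => w j.rev) 0)) := by
  rw [← Metric.cobounded_eq_cocompact]
  refine Tendsto.congr' ?_ ((P.reverse.continuousAt_weightedResolventNorm (fun j => w j.rev)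
    (P.zero_notMem_eigenvalues_reverse hP)).tendsto.comp tendsto_inv₀_cobounded)
  filter_upwards [Bornology.eventually_ne_cobounded 0] with z hz
  exact (P.weightedResolventNorm_eq_reverse w hz).symm

theorem weightedResolventNorm_eventually_eq_of_eventually_le (P : MatrixPolynomial n m)
    (hP : P.leadingCoeff.det ≠ 0) {w : Fin (m + 1) → ℝ} (hw : ∀ j, 0 ≤ w j)
    (hle : ∀ᶠ z in cocompact ℂ, P.weightedResolventNorm w z ≤
      P.reverse.weightedResolventNorm (fun j => w j.rev) 0) :
    ∀ᶠ z in cocompact ℂ, P.weightedResolventNorm w z =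
      P.reverse.weightedResolventNorm (fun j => w j.rev) 0 := by
  rw [← Metric.cobounded_eq_cocompact] at hle ⊢
  have hloc : IsLocalMax (P.reverse.weightedResolventNorm fun j => w j.rev) 0 := by
    have := tendsto_inv₀_nhdsNE_zero.eventually hle
    rw [eventually_nhdsWithin_iff] at this
    filter_upwards [this] with y hy
    by_cases hy0 : y = 0
    · rw [hy0]
    · have := hy hy0
      rwa [P.weightedResolventNorm_eq_reverse w (inv_ne_zero hy0), inv_inv] at this
  have := tendsto_inv₀_cobounded.eventually
    (P.reverse.weightedResolventNorm_eventually_eq_of_isLocalMax (fun j => hw j.rev)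
      (P.zero_notMem_eigenvalues_reverse hP) hloc)
  filter_upwards [this, Bornology.eventually_ne_cobounded 0] with z hz hz0
  rw [P.weightedResolventNorm_eq_reverse w hz0, hz]

/-- Without eigenvalues `P⁻¹` is entire and vanishes at infinity, hence is zero by Liouville. The
decay is the limit at infinity for the weights `(1, 0, …, 0)`: reversed, their sum vanishes at `0`
because `m ≥ 1`. -/
theorem nonempty_eigenvalues [NeZero n] (hm : 1 ≤ m) (P : MatrixPolynomial n m)
    (hP : P.leadingCoeff.det ≠ 0) : P.eigenvalues.Nonempty := by
  by_contra hE
  rw [Set.not_nonempty_iff_eq_empty] at hE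
  have hnot : ∀ z, z ∉ P.eigenvalues := by simp [hE]
  have hd : Differentiable ℂ fun z => (P.eval z)⁻¹ := fun z =>
    P.differentiableAt_inv_eval (hnot z)
  have hlim : Tendsto (fun z => (P.eval z)⁻¹) (cocompact ℂ) (𝓝 0) := by
    rw [tendsto_zero_iff_norm_tendsto_zero]
    have h0 : Fin.last m ≠ 0 := Fin.val_ne_zero_iff.mp (Nat.one_le_iff_ne_zero.mp hm)
    have hw : ∀ z, P.weightedResolventNorm (Pi.single 0 1) z = ‖(P.eval z)⁻¹‖ := by
      simp [weightedResolventNorm, Pi.single_apply]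
    have hsum : ∑ j : Fin (m + 1), (Pi.single 0 1 : Fin (m + 1) → ℝ) j.rev * ‖(0 : ℂ)‖ ^ (j : ℕ)
        = 0 := by
      refine Finset.sum_eq_zero fun j _ => ?_
      by_cases hj : j = 0
      · simp [hj, h0]
      · rw [norm_zero, zero_pow (Fin.val_ne_zero_iff.mpr hj), mul_zero]
    have := P.weightedResolventNorm_tendsto_cocompact hP (Pi.single 0 1)
    rw [weightedResolventNorm, hsum, mul_zero] at this
    exact this.congr hw
  have hzero : (P.eval 0)⁻¹ = 0 := hd.apply_eq_of_tendsto_cocompact 0 hlim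
  have h1 := Matrix.mul_nonsing_inv (P.eval 0) (Ne.isUnit (hnot 0))
  rw [hzero, mul_zero] at h1
  exact zero_ne_one h1

/-! ### The pseudospectrum as a superlevel set, and the count -/

/-- Admissible perturbations move `P(z)` by at most `ε * W`, and a suitable singularizing
perturbation of `P(z)` within that bound can be realized. The eigenvalues are adjoined separately
since the default inverse makes `F` vanish there. -/
theorem pseudospectrum_eq [NeZero n] (P : MatrixPolynomial n m) {w : Fin (m + 1) → ℝ}
    (hw : ∀ j, 0 ≤ w j) (hw0 : 0 < w 0) {ε : ℝ} (hε : 0 < ε) :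
    P.pseudospectrum w ε = P.eigenvalues ∪ {z | ε⁻¹ ≤ P.weightedResolventNorm w z} := by
  ext z
  set W := ∑ j : Fin (m + 1), w j * ‖z‖ ^ (j : ℕ) with hW
  by_cases hz : z ∈ P.eigenvalues
  · refine iff_of_true ⟨P, fun j => ?_, hz⟩ (Or.inl hz)
    simpa using mul_nonneg hε.le (hw j)
  rw [Set.mem_union, or_iff_right hz, Set.mem_ofPred_eq, inv_le_iff_one_le_mul₀ hε]
  constructor
  · rintro ⟨Q, hQ, hdet⟩
    have h1 := Matrix.one_le_norm_inv_mul_norm_sub hz hdet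
    have h2 : ‖P.eval z - Q.eval z‖ ≤ ε * W := by
      rw [norm_sub_rev, eval, eval, ← Finset.sum_sub_distrib, hW, Finset.mul_sum]
      refine norm_sum_le_of_le _ fun j _ => ?_
      rw [← smul_sub, norm_smul, norm_pow]
      calc ‖z‖ ^ (j : ℕ) * ‖Q j - P j‖ ≤ ‖z‖ ^ (j : ℕ) * (ε * w j) := by
            gcongr
            exact hQ j
        _ = ε * (w j * ‖z‖ ^ (j : ℕ)) := by ring
    calc 1 ≤ ‖(P.eval z)⁻¹‖ * ‖P.eval z - Q.eval z‖ := h1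
      _ ≤ ‖(P.eval z)⁻¹‖ * (ε * W) := by gcongr
      _ = P.weightedResolventNorm w z * ε := by rw [weightedResolventNorm]; ring
  · intro h
    have hWpos : 0 < W := by
      refine Finset.sum_pos' (fun j _ => mul_nonneg (hw j) (by positivity)) ⟨0, Finset.mem_univ _, ?_⟩
      simpa using hw0
    obtain ⟨D, hD, hdet⟩ := Matrix.exists_norm_le_det_add_eq_zero hz
    have hDW : ‖D‖ ≤ ε * W := by
      refine hD.trans ?_
      rw [weightedResolventNorm, ← hW, mul_assoc] at h
      refine inv_le_of_inv_le₀ (by positivity) ?_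
      rw [inv_le_iff_one_le_mul₀ (by positivity)]
      linarith
    choose a ha haz using fun j : Fin (m + 1) => exists_norm_eq_one_mul_pow z j
    -- Distribute `D` over the coefficients in proportion to the weights; the phase `a j` cancels
    -- that of `z ^ j`, so the contributions at `z` add up to exactly `D`.
    refine ⟨fun j => P j + ((w j / W : ℝ) * a j) • D, fun j => ?_, ?_⟩
    · rw [add_sub_cancel_left, norm_smul, norm_mul, ha, mul_one, Complex.norm_real,
        Real.norm_of_nonneg (div_nonneg (hw j) hWpos.le)]
      calc w j / W * ‖D‖ ≤ w j / W * (ε * W) := by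
            have := hw j
            gcongr
        _ = ε * w j := by field_simp
    · have hsum : ∑ j : Fin (m + 1), z ^ (j : ℕ) * ((w j / W : ℝ) * a j) = 1 := by
        have : ∀ j : Fin (m + 1), z ^ (j : ℕ) * ((w j / W : ℝ) * a j) =
            ((w j * ‖z‖ ^ (j : ℕ) / W : ℝ) : ℂ) := by
          intro j
          rw [mul_left_comm, mul_comm (z ^ _), haz]
          push_cast
          ring
        rw [Finset.sum_congr rfl fun j _ => this j, ← Complex.ofReal_sum, ← Finset.sum_div, ← hW,
          div_self hWpos.ne', Complex.ofReal_one]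
      have heval : eval (fun j => P j + ((w j / W : ℝ) * a j) • D) z = P.eval z + D := by
        simp only [eval, smul_add, Finset.sum_add_distrib, smul_smul]
        rw [← Finset.sum_smul, hsum, one_smul]
      rw [heval, hdet]

end MatrixPolynomial

theorem mainTheorem1 {n m : ℕ} (hm : 1 ≤ m) (P : MatrixPolynomial n m)
    (hP : P.leadingCoeff.det ≠ 0)
    (w : Fin (m + 1) → ℝ) (hw : ∀ j, 0 ≤ w j) (hw0 : 0 < w 0)
    (k : ℕ) (hk : P.eigenvalues.encard = (k : ℕ∞))
    (ε : ℝ) (hε : 0 < ε) :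
    ENat.card (ConnectedComponents (P.pseudospectrum w ε)) ≤ (k : ℕ∞) := by
  rcases Nat.eq_zero_or_pos n with rfl | hn
  -- The empty matrix has determinant `1`, so for `n = 0` there are no eigenvalues and no
  -- pseudospectrum.
  · have : IsEmpty (P.pseudospectrum w ε) :=
      ⟨fun ⟨z, Q, _, hdet⟩ => one_ne_zero (Matrix.det_fin_zero.symm.trans hdet)⟩
    have : IsEmpty (ConnectedComponents (P.pseudospectrum w ε)) :=
      ConnectedComponents.surjective_coe.isEmpty
    exact (ENat.card_eq_zero_iff_empty _).mpr this ▸ zero_le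
  have : NeZero n := ⟨hn.ne'⟩
  have hfin : P.eigenvalues.Finite := Set.encard_lt_top_iff.mp (hk ▸ ENat.natCast_lt_top k)
  have h : HasMaximumPrincipleOffPoles (P.weightedResolventNorm w) P.eigenvalues
      (P.reverse.weightedResolventNorm (fun j => w j.rev) 0) :=
    { finite := hfin
      nonempty := P.nonempty_eigenvalues hm hP
      continuousAt := fun _ hz => P.continuousAt_weightedResolventNorm w hz
      tendsto_atTop := fun _ hz => P.weightedResolventNorm_tendsto_atTop hw hw0 hfin hz
      eventually_eq_of_isLocalMax := fun _ hz =>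
        P.weightedResolventNorm_eventually_eq_of_isLocalMax hw hz
      tendsto_cocompact := P.weightedResolventNorm_tendsto_cocompact hP w
      eventually_eq_of_eventually_le :=
        P.weightedResolventNorm_eventually_eq_of_eventually_le hP hw }
  rw [P.pseudospectrum_eq hw hw0 hε, ← hk]
  exact h.card_connectedComponents_le ε⁻¹
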